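/- Let $k$ be an algebraically closed field of characteristic $0$ or $p>d$, where $d\ge 2$, and let $N\ge 0$. For an algebraically closed field $L$, $A\in\mathrm{SL}_N(L)$ and $\mathbf b\in L^N$, let $f_{A,\mathbf b}:\mathbb P^N_L\to\mathbb P^N_L$ be the extension to $\mathbb P^N$ of the map $\mathbf X\mapsto A\mathbf X^d+\mathbf b$ of $\mathbb A^N$, where $\mathbf X^d$ is the coordinatewise power. An endomorphism $f$ of $\mathbb P^N_L$ is called post-critically finite (PCF) if $P_f=\bigcup_{n\ge 1}f^n(C_f)$ is a proper Zariski closed subset of $\mathbb P^N$, where $C_f$ is the critical locus, defined by the vanishing of the determinant of the Jacobian of homogeneous forms representing $f$. Let $V$ be a variety over $k$ (an integral separated $k$-scheme of finite type) with function field $k(V)$. A family of such maps over $V$ is given by $A\in\mathrm{SL}_N(\Gamma(V,\mathcal O_V))$ and $\mathbf b\in\Gamma(V,\mathcal O_V)^N$. (1) There is no family over $V$ for which the generic member $f_{A,\mathbf b}$, regarded as a map over $\overline{k(V)}$, is PCF, such that $A$ is constant (i.e. comes from $\mathrm{SL}_N(k)$) but $\mathbf b$ is non-constant (i.e. does not come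 from $k^N$). (2) If $k$ is not an algebraic closure of a finite field, there is also no family over $V$ all of whose members $f_{A(t),\mathbf b(t)}$, $t\in V(k)$, are PCF, such that $A$ is constant but $\mathbf b$ is non-constant. -/

import Mathlib

open CategoryTheory AlgebraicGeometry

universe u

namespace PCF

/-- The projective space with homogeneous coordinates indexed by `ι` (dimension `#ι - 1`),
through its points over the field `K`. -/
abbrev PSpace (K ι : Type*) [Field K] := Projectivization K (ι → K)

/-- The common zeros in projective space of a set of forms. The polynomials used below are
homogeneous, so that the choice of the representative `P.rep` is irrelevant. -/
def zeroLocus {K ι : Type*} [Field K] (S : Set (MvPolynomial ι K)) : Set (PSpace K ι) :=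
  {P | ∀ G ∈ S, MvPolynomial.eval P.rep G = 0}

/-- Algebraic (that is, Zariski closed) subsets of projective space. -/
def IsAlgebraicSet {K ι : Type*} [Field K] (Z : Set (PSpace K ι)) : Prop :=
  ∃ S : Set (MvPolynomial ι K), (∀ G ∈ S, ∃ m : ℕ, G.IsHomogeneous m) ∧ Z = zeroLocus S

/-- A degree `d` endomorphism of projective space over an algebraically closed field, given by
forms of degree `d` without a common zero. -/
structure ProjEndo (K ι : Type*) [Field K] [IsAlgClosed K] (d : ℕ) where
  form : ι → MvPolynomial ι K
  homogeneous : ∀ i, (form i).IsHomogeneous d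
  noCommonZero : ∀ x : ι → K, (∀ i, MvPolynomial.eval x (form i) = 0) → x = 0

theorem eval_smul_of_isHomogeneous {K ι : Type*} [Field K] {d : ℕ} {F : MvPolynomial ι K}
    (hF : F.IsHomogeneous d) (t : K) (x : ι → K) :
    MvPolynomial.eval (t • x) F = t ^ d * MvPolynomial.eval x F := by
  rw [MvPolynomial.eval_eq, MvPolynomial.eval_eq, Finset.mul_sum]
  refine Finset.sum_congr rfl fun m hm => ?_
  have h := hF (MvPolynomial.mem_support_iff.mp hm)
  rw [Finsupp.weight_apply, Finsupp.sum] at h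
  simp only [Pi.smul_apply, smul_eq_mul, mul_pow, Finset.prod_mul_distrib,
    Finset.prod_pow_eq_pow_sum]
  simp only [Pi.one_apply, smul_eq_mul, mul_one] at h
  rw [h]
  ring

namespace ProjEndo

variable {K ι : Type*} [Field K] [IsAlgClosed K] {d : ℕ}

/-- The map on points `[x] ↦ [F(x)]`. -/
noncomputable def toFun (f : ProjEndo K ι d) : PSpace K ι → PSpace K ι :=
  Projectivization.lift
    (fun x => Projectivization.mk K (fun i => MvPolynomial.eval x.1 (f.form i))
      (fun h => x.2 (f.noCommonZero x.1 (fun i => congrFun h i))))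
    (by
      intro a b t hab
      rw [Projectivization.mk_eq_mk_iff']
      refine ⟨t ^ d, ?_⟩
      funext i
      rw [hab, eval_smul_of_isHomogeneous (f.homogeneous i)]
      rfl)

/-- The Jacobian matrix of the forms. -/
noncomputable def jacobian (f : ProjEndo K ι d) : Matrix ι ι (MvPolynomial ι K) :=
  Matrix.of fun i j => MvPolynomial.pderiv j (f.form i)

variable [Fintype ι] [DecidableEq ι]

/-- The critical locus: the vanishing of the determinant of the Jacobian. -/
noncomputable def criticalLocus (f : ProjEndo K ι d) : Set (PSpace K ι) :=
  zeroLocus {f.jacobian.det}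

/-- The post-critical locus `⋃_{n ≥ 1} fⁿ(C_f)`. -/
noncomputable def postCriticalLocus (f : ProjEndo K ι d) : Set (PSpace K ι) :=
  ⋃ n : ℕ, ⋃ _ : 1 ≤ n, f.toFun^[n] '' f.criticalLocus

/-- Post-critically finite: the post-critical locus is algebraic. Being a countable union of
hypersurfaces, it is then a proper subset (as a subset of the scheme it always misses the generic
point); as we work with points over a possibly countable field, properness is spelled out. -/
def IsPCF (f : ProjEndo K ι d) : Prop :=
  IsAlgebraicSet f.postCriticalLocus ∧ f.postCriticalLocus ≠ Set.univ

end ProjEndo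

/-- The matrix `(A b; 0 1)`. -/
def blockMatrix {R : Type*} [CommRing R] {N : ℕ} (A : Matrix.SpecialLinearGroup (Fin N) R)
    (b : Fin N → R) : Matrix (Fin N ⊕ Unit) (Fin N ⊕ Unit) R :=
  Matrix.fromBlocks A.1 (Matrix.of fun i _ => b i) 0 1

/-- The extension to projective `N`-space of the self-map `X ↦ A X^d + b` of affine `N`-space,
where `X^d` is the coordinatewise power: the `i`-th form is `∑ j, L i j * X j ^ d`, for
`L = (A b; 0 1)`. The coordinate at `Sum.inr ()` is the homogenizing one. -/
noncomputable def unicritical {K : Type*} [Field K] [IsAlgClosed K] {N d : ℕ} (hd : 2 ≤ d)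
    (A : Matrix.SpecialLinearGroup (Fin N) K) (b : Fin N → K) :
    ProjEndo K (Fin N ⊕ Unit) d where
  form i := ∑ j, MvPolynomial.C (blockMatrix A b i j) * MvPolynomial.X j ^ d
  homogeneous i := by
    refine MvPolynomial.IsHomogeneous.sum _ _ _ fun j _ => ?_
    simpa using ((MvPolynomial.isHomogeneous_X K j).pow d).C_mul (blockMatrix A b i j)
  noCommonZero x hx := by
    have h1 : (blockMatrix A b).mulVec (fun j => x j ^ d) = 0 := by
      funext i
      simpa [Matrix.mulVec, dotProduct] using hx i
    have h2 : (blockMatrix A b).det ≠ 0 := by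
      simp [blockMatrix]
    have h3 := Matrix.eq_zero_of_mulVec_eq_zero h2 h1
    funext j
    exact (pow_eq_zero_iff (by omega)).mp (congrFun h3 j)

/-- The constants: the ring map from `k` to the regular functions on a `k`-scheme `V`. -/
noncomputable def const {k : Type u} [Field k] {V : Scheme.{u}} (π : V ⟶ Spec (.of k)) :
    k →+* Γ(V, ⊤) :=
  ((Scheme.ΓSpecIso (.of k)).inv ≫ π.appTop).hom

/-- The coefficients of an algebraic family of maps `X ↦ A X^d + b` over `V`: a morphism from `V`
to `SL_N × 𝔸^N`, given by regular functions on `V`. -/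
structure Family (V : Scheme.{u}) (N : ℕ) where
  A : Matrix.SpecialLinearGroup (Fin N) Γ(V, ⊤)
  b : Fin N → Γ(V, ⊤)

namespace Family

variable {V : Scheme.{u}} {N : ℕ}

/-- The member of the family obtained by mapping its coefficients to a field. -/
noncomputable def specialize (f : Family V N) {d : ℕ} (hd : 2 ≤ d) {L : Type u} [Field L]
    [IsAlgClosed L] (φ : Γ(V, ⊤) →+* L) : ProjEndo L (Fin N ⊕ Unit) d :=
  unicritical hd (Matrix.SpecialLinearGroup.map φ f.A) (fun i => φ (f.b i))

/-- The family, seen as a single map with coefficients in the function field of `V` (embedded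
in its algebraic closure). -/
noncomputable def genericMember (f : Family V N) [IsIntegral V] {d : ℕ} (hd : 2 ≤ d) :
    ProjEndo (AlgebraicClosure V.functionField) (Fin N ⊕ Unit) d :=
  f.specialize hd
    ((algebraMap V.functionField (AlgebraicClosure V.functionField)).comp
      (V.presheaf.germ ⊤ (genericPoint V) trivial).hom)

/-- The member of the family at a point of `V` with values in an algebraically closed field. -/
noncomputable def member (f : Family V N) {d : ℕ} (hd : 2 ≤ d) {L : Type u} [Field L]
    [IsAlgClosed L] (t : Spec (.of L) ⟶ V) : ProjEndo L (Fin N ⊕ Unit) d :=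
  f.specialize hd (t.appTop ≫ (Scheme.ΓSpecIso (.of L)).hom).hom

/-- The matrix `A` of the family is constant. -/
def ConstantA {k : Type u} [Field k] (π : V ⟶ Spec (.of k)) (f : Family V N) : Prop :=
  ∃ A₀ : Matrix.SpecialLinearGroup (Fin N) k,
    f.A = Matrix.SpecialLinearGroup.map (const π) A₀

/-- The vector `b` of the family is constant. -/
def ConstantB {k : Type u} [Field k] (π : V ⟶ Spec (.of k)) (f : Family V N) : Prop :=
  ∃ b₀ : Fin N → k, ∀ i, f.b i = const π (b₀ i)

end Family

end PCF

/-!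
Each irreducible component of the critical locus of a PCF map is preperiodic: its forward images
are all components of the post-critical locus, and there are only finitely many of these. In terms
of forms, if `G` is a form vanishing on the post-critical locus, then the contractions of a
critical prime along the iterates of the map are all minimal over the principal ideal `(G)`.

For `f(x) = A x^d + b` the coordinate hyperplanes are critical. Suppose that, for some valuation
ring `O` of the ground field, the entries of `A` lie in `O` but those of `b` do not. Then the orbit
of the origin escapes: `|f^n(0)| = |b|^(d^(n-1))` for the supremum norm. If `j` is an index at which
`|A⁻¹ b|` is attained, then so does every point `y` of the hyperplane `x_j = 0`, as
`|f(y)| ≥ |(A⁻¹ f(y))_j| = |(A⁻¹ b)_j| = |b|`. So all points of `f^n(x_j = 0)` are larger than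
`f^m(0)` if `n > m ≥ 1`, and `x_j = 0` is not preperiodic.

Hence `b` is integral over every ring over which `A` is integral. Over the algebraic closure of
`k(V)` and with the ring `k`, this gives part (1). For part (2), take the ring generated by the
entries of `A`: unless `k` is algebraic over a finite field, infinitely many elements of `k` are not
integral over it, whereas a non-constant regular function takes all but finitely many values at the
`k`-points.
-/

namespace PCF

section CommutativeAlgebra

theorem isIntegral_of_forall_valuationSubring {R K : Type*} [CommRing R] [Field K] [Algebra R K]
    {x : K} (h : ∀ O : ValuationSubring K, (∀ r, algebraMap R K r ∈ O) → x ∈ O) :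
    IsIntegral R x := by
  by_contra hx
  have : IsIntegrallyClosedIn (integralClosure R K).toSubring K :=
    inferInstanceAs (IsIntegrallyClosedIn (integralClosure R K) K)
  obtain ⟨O, hO, hxO⟩ := Subring.exists_le_valuationSubring_of_isIntegrallyClosedIn
    (R := (integralClosure R K).toSubring) (x := x) hx
  exact hxO (h O fun r => hO ((integralClosure R K).algebraMap_mem r))

theorem valuation_le_one_of_isIntegral {R K Γ₀ : Type*} [CommRing R] [Field K] [Algebra R K]
    [LinearOrderedCommGroupWithZero Γ₀] {v : Valuation K Γ₀}
    (hv : ∀ r, v (algebraMap R K r) ≤ 1) {x : K} (hx : IsIntegral R x) : v x ≤ 1 := by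
  obtain ⟨p, hp, hpx⟩ := hx
  refine (Valuation.integer.integers v).mem_of_integral
    ⟨p.map ((algebraMap R K).codRestrict v.integer hv), hp.map _, ?_⟩
  rw [Polynomial.eval₂_map]
  exact hpx

theorem isIntegralElem_of_forall_valuationSubring {R S : Type*} [CommRing R] [CommRing S]
    [IsDomain S] {φ : R →+* S} {y : S}
    (h : ∀ O : ValuationSubring (FractionRing S), (∀ r, algebraMap S (FractionRing S) (φ r) ∈ O) →
      algebraMap S (FractionRing S) y ∈ O) : φ.IsIntegralElem y := by
  algebraize [(algebraMap S (FractionRing S)).comp φ]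
  obtain ⟨q, hq, hqy⟩ := isIntegral_of_forall_valuationSubring (R := R) h
  refine ⟨q, hq, FaithfulSMul.algebraMap_injective S (FractionRing S) ?_⟩
  rwa [map_zero, Polynomial.hom_eval₂]

theorem exists_algebraMap_eq_of_isIntegral {k D : Type*} [Field k] [IsAlgClosed k] [CommRing D]
    [IsDomain D] [Algebra k D] {x : D} (hx : IsIntegral k x) : ∃ c, algebraMap k D c = x := by
  obtain ⟨c, hc⟩ := (IsAlgClosed.algebraMap_bijective_of_isIntegral
    (k := k) (K := integralClosure k D)).2 ⟨x, hx⟩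
  exact ⟨c, congrArg Subtype.val hc⟩

theorem comap_span_singleton_mem_minimalPrimes {R S : Type*} [CommRing R] [IsDomain R]
    [IsNoetherianRing R] [IsIntegrallyClosed R] [CommRing S] [IsDomain S] [IsNoetherianRing S]
    {φ : R →+* S} (hφ : φ.IsIntegral) (hinj : Function.Injective φ) {x : S} (hx : Prime x)
    {G : R} (hG : G ≠ 0) (hGx : x ∣ φ G) :
    (Ideal.span {x}).comap φ ∈ (Ideal.span {G}).minimalPrimes := by
  algebraize [φ]
  have : FaithfulSMul R S := (faithfulSMul_iff_algebraMap_injective R S).mpr hinj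
  have : (Ideal.span {x}).IsPrime := (Ideal.span_singleton_prime hx.ne_zero).mpr hx
  have : (Ideal.span {x}).LiesOver ((Ideal.span {x}).comap φ) := ⟨rfl⟩
  refine Ideal.mem_minimalPrimes_of_height_le
    ((Ideal.span_singleton_le_iff_mem _).mpr (Ideal.mem_span_singleton.mpr hGx)) ?_
  calc ((Ideal.span {x}).comap φ).height
      ≤ (Ideal.span {x}).height := by
        rw [Ideal.height_eq_height_add_of_liesOver_of_hasGoingDown ((Ideal.span {x}).comap φ)
          (Ideal.span {x})]
        exact le_self_add
    _ ≤ 1 := Ideal.height_span_singleton_le_one hx.not_isUnit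
    _ ≤ (Ideal.span {G}).height :=
        Ideal.one_le_height_span_singleton_of_mem_nonZeroDivisors
          (mem_nonZeroDivisors_of_ne_zero hG)

theorem eval_rep_mk_eq_zero_iff {K ι : Type*} [Field K] {m : ℕ} {G : MvPolynomial ι K}
    (hG : G.IsHomogeneous m) {x : ι → K} (hx : x ≠ 0) :
    MvPolynomial.eval (Projectivization.mk K x hx).rep G = 0 ↔ MvPolynomial.eval x G = 0 := by
  obtain ⟨a, ha⟩ := Projectivization.exists_smul_eq_mk_rep K x hx
  rw [← ha, Units.smul_def, eval_smul_of_isHomogeneous hG]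
  simp

theorem exists_isMaximal_comap_eq_of_isIntegral {R S : Type*} [CommRing R] [CommRing S]
    {φ : R →+* S} (hφ : φ.IsIntegral) {M : Ideal R} (hM : M.IsMaximal) {I : Ideal S}
    (hI : I.comap φ ≤ M) : ∃ Q : Ideal S, Q.IsMaximal ∧ I ≤ Q ∧ Q.comap φ = M := by
  algebraize [φ]
  obtain ⟨Q, hIQ, hQ, hQM⟩ := Ideal.exists_ideal_over_prime_of_isIntegral M I hI
  exact ⟨Q, Ideal.isMaximal_of_isIntegral_of_isMaximal_comap Q (by rwa [hQM]), hIQ, hQM⟩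

theorem exists_zero_of_isIntegral_of_comap_le_vanishingIdeal {K σ τ : Type*} [Field K]
    [IsAlgClosed K] [Finite σ] [Finite τ] {φ : MvPolynomial σ K →+* MvPolynomial τ K}
    (hφ : φ.IsIntegral) {I : Ideal (MvPolynomial τ K)} {y : σ → K}
    (hy : I.comap φ ≤ MvPolynomial.vanishingIdeal K {y}) :
    ∃ x : τ → K, I ≤ MvPolynomial.vanishingIdeal K {x} ∧
      (MvPolynomial.vanishingIdeal K {x}).comap φ = MvPolynomial.vanishingIdeal K {y} := by
  obtain ⟨Q, hQ, hIQ, hQy⟩ := exists_isMaximal_comap_eq_of_isIntegral hφ inferInstance hy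
  obtain ⟨x, rfl⟩ := MvPolynomial.isMaximal_iff_eq_vanishingIdeal_singleton.mp hQ
  exact ⟨x, hIQ, hQy⟩

end CommutativeAlgebra

namespace ProjEndo

variable {K ι : Type*} [Field K] [IsAlgClosed K] {d : ℕ}

/-- The lift `x ↦ F(x)` of an endomorphism `[x] ↦ [F(x)]` to homogeneous coordinates. -/
noncomputable def coordMap (f : ProjEndo K ι d) (x : ι → K) : ι → K :=
  fun i => MvPolynomial.eval x (f.form i)

theorem coordMap_ne_zero (f : ProjEndo K ι d) {x : ι → K} (hx : x ≠ 0) : f.coordMap x ≠ 0 :=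
  fun h => hx (f.noCommonZero x fun i => congrFun h i)

theorem coordMap_smul (f : ProjEndo K ι d) (t : K) (x : ι → K) :
    f.coordMap (t • x) = t ^ d • f.coordMap x :=
  funext fun i => eval_smul_of_isHomogeneous (f.homogeneous i) t x

theorem iterate_coordMap_ne_zero (f : ProjEndo K ι d) {x : ι → K} (hx : x ≠ 0) (n : ℕ) :
    f.coordMap^[n] x ≠ 0 := by
  induction n with
  | zero => exact hx
  | succ n ih => rw [Function.iterate_succ_apply']; exact f.coordMap_ne_zero ih

theorem iterate_coordMap_smul (f : ProjEndo K ι d) (t : K) (x : ι → K) (n : ℕ) :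
    f.coordMap^[n] (t • x) = t ^ d ^ n • f.coordMap^[n] x := by
  induction n generalizing t x with
  | zero => simp
  | succ n ih => rw [Function.iterate_succ_apply, coordMap_smul, ih, ← pow_mul, ← pow_succ',
      Function.iterate_succ_apply]

theorem iterate_toFun_mk (f : ProjEndo K ι d) {x : ι → K} (hx : x ≠ 0) (n : ℕ) :
    f.toFun^[n] (Projectivization.mk K x hx) =
      Projectivization.mk K (f.coordMap^[n] x) (f.iterate_coordMap_ne_zero hx n) := by
  induction n with
  | zero => rfl
  | succ n ih =>
    rw [Function.iterate_succ_apply', ih]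
    simp only [Function.iterate_succ_apply']
    rfl

/-- Substitution of the forms of `f` into a polynomial, that is, the action on regular functions
of the self-map `f.coordMap` of affine space. -/
noncomputable def pullback (f : ProjEndo K ι d) : MvPolynomial ι K →+* MvPolynomial ι K :=
  (MvPolynomial.aeval f.form).toRingHom

theorem eval_pullback (f : ProjEndo K ι d) (x : ι → K) (p : MvPolynomial ι K) :
    MvPolynomial.eval x (f.pullback p) = MvPolynomial.eval (f.coordMap x) p :=
  MvPolynomial.comp_aeval_apply f.form (MvPolynomial.aeval (R := K) x) p

theorem eval_pullback_pow (f : ProjEndo K ι d) (n : ℕ) (x : ι → K) (p : MvPolynomial ι K) :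
    MvPolynomial.eval x ((f.pullback ^ n) p) = MvPolynomial.eval (f.coordMap^[n] x) p := by
  induction n generalizing x with
  | zero => rfl
  | succ n ih =>
    rw [pow_succ', RingHom.mul_def, RingHom.comp_apply, eval_pullback, ih,
      Function.iterate_succ_apply]

theorem exists_X_pow_mem_span_form [Finite ι] (f : ProjEndo K ι d) (i : ι) :
    ∃ m, MvPolynomial.X i ^ m ∈ Ideal.span (Set.range f.form) := by
  have h : MvPolynomial.X i ∈ MvPolynomial.vanishingIdeal K
      (MvPolynomial.zeroLocus K (Ideal.span (Set.range f.form))) := by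
    rw [MvPolynomial.mem_vanishingIdeal_iff, MvPolynomial.zeroLocus_span]
    intro x hx
    have h0 : x = 0 := f.noCommonZero x fun i => hx (f.form i) ⟨i, rfl⟩
    simp [h0]
  rwa [MvPolynomial.vanishingIdeal_zeroLocus_eq_radical] at h

theorem mem_of_forall_aeval_form_mem [Finite ι] (f : ProjEndo K ι d) (hd : d ≠ 0) {L : Type*}
    [Field L] [Algebra K L] {O : ValuationSubring L} (hK : ∀ c, algebraMap K L c ∈ O) {x : ι → L}
    (hx : ∀ i, MvPolynomial.aeval x (f.form i) ∈ O) (i : ι) : x i ∈ O := by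
  have : Nonempty ι := ⟨i⟩
  obtain ⟨j, hj⟩ := Finite.exists_max fun i => O.valuation (x i)
  by_contra hi
  have hxj : 1 < O.valuation (x j) := by
    rw [← O.valuation_le_one_iff, not_le] at hi
    exact hi.trans_le (hj i)
  have hxj0 : x j ≠ 0 := (O.valuation.ne_zero_iff).mp (zero_lt_one.trans hxj).ne'
  let y : ι → O := fun i => ⟨(x j)⁻¹ * x i, by
    rw [← O.valuation_le_one_iff, map_mul, map_inv₀]
    exact inv_mul_le_one_of_le₀ (hj i) zero_le⟩
  let φ : MvPolynomial ι K →+* O :=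
    MvPolynomial.eval₂Hom ((algebraMap K L).codRestrict O hK) y
  have hφ (p : MvPolynomial ι K) : (φ p : L) = MvPolynomial.aeval ((x j)⁻¹ • x) p :=
    MvPolynomial.eval₂_comp_left O.subtype _ _ _
  have hform : Ideal.span (Set.range f.form) ≤ (IsLocalRing.maximalIdeal O).comap φ := by
    rw [Ideal.span_le]
    rintro _ ⟨i, rfl⟩
    rw [SetLike.mem_coe, Ideal.mem_comap, O.valuation_lt_one_iff, hφ,
      MvPolynomial.aeval_def, MvPolynomial.eval₂_eq_eval_map,
      eval_smul_of_isHomogeneous ((f.homogeneous i).map _),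
      ← MvPolynomial.eval₂_eq_eval_map, ← MvPolynomial.aeval_def, map_mul, map_pow, map_inv₀]
    exact mul_lt_one_of_lt_of_le (pow_lt_one₀ zero_le (inv_lt_one_of_one_lt₀ hxj) hd)
      ((O.valuation_le_one_iff _).mpr (hx i))
  obtain ⟨m, hm⟩ := f.exists_X_pow_mem_span_form j
  have hone : φ (MvPolynomial.X j ^ m) = 1 := by
    rw [map_pow, show φ (MvPolynomial.X j) = 1 from Subtype.ext (by simp [hφ, hxj0]), one_pow]
  exact (IsLocalRing.maximalIdeal.isMaximal O).ne_top
    ((Ideal.eq_top_iff_one _).mpr (hone ▸ hform hm))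

theorem pullback_isIntegral [Finite ι] (f : ProjEndo K ι d) (hd : d ≠ 0) :
    f.pullback.IsIntegral := by
  intro p
  let X (i : ι) := algebraMap (MvPolynomial ι K) (FractionRing (MvPolynomial ι K)) (.X i)
  have hX (q : MvPolynomial ι K) : algebraMap _ _ q = MvPolynomial.aeval X q := by
    conv_lhs => rw [← MvPolynomial.aeval_X_left_apply q]
    exact MvPolynomial.comp_aeval_apply _ (IsScalarTower.toAlgHom K _ _) q
  refine isIntegralElem_of_forall_valuationSubring fun O hO => ?_
  have hK (c : K) : algebraMap K _ c ∈ O := by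
    simpa [pullback, IsScalarTower.algebraMap_apply K (MvPolynomial ι K)] using hO (.C c)
  have hform (i : ι) : MvPolynomial.aeval X (f.form i) ∈ O := by
    simpa [pullback, hX] using hO (.X i)
  rw [hX]
  exact MvPolynomial.eval₂_mem (fun m _ => hK _)
    (f.mem_of_forall_aeval_form_mem hd hK hform)

theorem pullback_injective [Finite ι] (f : ProjEndo K ι d) (hd : d ≠ 0) :
    Function.Injective f.pullback := by
  have hint : Algebra.IsIntegral (Algebra.adjoin K (Set.range f.form)) (MvPolynomial ι K) := by
    rw [Algebra.adjoin_range_eq_range_aeval, ← algebraMap_isIntegral_iff]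
    exact RingHom.IsIntegral.tower_top (MvPolynomial.aeval f.form).rangeRestrict.toRingHom _
      (f.pullback_isIntegral hd)
  have hindep : AlgebraicIndependent K f.form :=
    (Algebra.IsAlgebraic.isTranscendenceBasis_of_lift_le_trdeg_of_finite K f.form
      (by simp [MvPolynomial.trdeg_of_isDomain])).1
  exact hindep

theorem pullback_pow_isIntegral [Finite ι] (f : ProjEndo K ι d) (hd : d ≠ 0) (n : ℕ) :
    (f.pullback ^ n).IsIntegral := by
  induction n with
  | zero => exact RingHom.isIntegral_of_surjective _ Function.surjective_id
  | succ n ih => exact pow_succ' f.pullback n ▸ ih.trans _ _ (f.pullback_isIntegral hd)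

theorem pullback_pow_injective [Finite ι] (f : ProjEndo K ι d) (hd : d ≠ 0) (n : ℕ) :
    Function.Injective (f.pullback ^ n) :=
  RingHom.coe_pow f.pullback n ▸ (f.pullback_injective hd).iterate n

theorem isHomogeneous_det_jacobian [Fintype ι] [DecidableEq ι] (f : ProjEndo K ι d) :
    f.jacobian.det.IsHomogeneous (Fintype.card ι * (d - 1)) := by
  rw [Matrix.det_apply]
  refine MvPolynomial.IsHomogeneous.sum _ _ _ fun σ _ => ?_
  rw [Units.smul_def, ← Int.cast_smul_eq_zsmul K, MvPolynomial.smul_eq_C_mul]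
  refine MvPolynomial.IsHomogeneous.C_mul ?_ _
  simpa [jacobian] using MvPolynomial.IsHomogeneous.prod Finset.univ _ (fun _ => d - 1)
    fun i _ => (f.homogeneous (σ i)).pderiv

theorem exists_form_vanishing_of_isPCF [Fintype ι] [DecidableEq ι] {f : ProjEndo K ι d}
    (hd : d ≠ 0) (hf : f.IsPCF) :
    ∃ G ≠ 0, ∀ n, 1 ≤ n → ∀ x, MvPolynomial.eval x f.jacobian.det = 0 →
      MvPolynomial.eval (f.coordMap^[n] x) G = 0 := by
  obtain ⟨⟨S, hS, hlocus⟩, hne⟩ := hf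
  obtain ⟨P, hP⟩ := (Set.ne_univ_iff_exists_notMem _).mp hne
  simp only [hlocus, zeroLocus, Set.mem_ofPred_eq, not_forall] at hP
  obtain ⟨G, hGS, hGP⟩ := hP
  obtain ⟨r, hr⟩ := hS G hGS
  obtain ⟨j, hj⟩ := Function.ne_iff.mp P.rep_nonzero
  refine ⟨.X j * G, fun h => ?_, fun n hn x hx => ?_⟩
  · refine mul_ne_zero hj hGP ?_
    simpa only [map_mul, MvPolynomial.eval_X, map_zero] using congrArg (MvPolynomial.eval P.rep) h
  rcases eq_or_ne x 0 with rfl | hx0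
  · have h0 : f.coordMap^[n] 0 = 0 := by
      simpa [hd] using f.iterate_coordMap_smul 0 0 n
    simp [h0]
  · have hmem : f.toFun^[n] (Projectivization.mk K x hx0) ∈ f.postCriticalLocus := by
      refine Set.mem_iUnion₂.mpr ⟨n, hn, _, ?_, rfl⟩
      rintro _ rfl
      exact (eval_rep_mk_eq_zero_iff f.isHomogeneous_det_jacobian hx0).mpr hx
    rw [hlocus, iterate_toFun_mk f hx0] at hmem
    rw [map_mul, (eval_rep_mk_eq_zero_iff hr _).mp (hmem G hGS), mul_zero]

theorem dvd_pullback_pow_iff [Finite ι] (f : ProjEndo K ι d) {q : MvPolynomial ι K} (hq : Prime q)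
    (n : ℕ) (p : MvPolynomial ι K) :
    q ∣ (f.pullback ^ n) p ↔
      ∀ x, MvPolynomial.eval x q = 0 → MvPolynomial.eval (f.coordMap^[n] x) p = 0 := by
  have := (Ideal.span_singleton_prime hq.ne_zero).mpr hq
  rw [← Ideal.mem_span_singleton, ← MvPolynomial.IsPrime.vanishingIdeal_zeroLocus (K := K)
    (Ideal.span {q}), MvPolynomial.mem_vanishingIdeal_iff, MvPolynomial.zeroLocus_span]
  simp [MvPolynomial.aeval_eq_eval, eval_pullback_pow, -RingHom.coe_pow]

theorem mem_image_iterate_coordMap_iff [Finite ι] (f : ProjEndo K ι d) (hd : d ≠ 0)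
    (q : MvPolynomial ι K) (n : ℕ) (y : ι → K) :
    y ∈ f.coordMap^[n] '' {x | MvPolynomial.eval x q = 0} ↔
      (Ideal.span {q}).comap (f.pullback ^ n) ≤ MvPolynomial.vanishingIdeal K {y} := by
  constructor
  · rintro ⟨x, hx, rfl⟩ p hp
    obtain ⟨r, hr⟩ := Ideal.mem_span_singleton.mp hp
    rw [MvPolynomial.mem_vanishingIdeal_singleton_iff, MvPolynomial.aeval_eq_eval,
      ← eval_pullback_pow, hr, map_mul, hx, zero_mul]
  · intro hy
    obtain ⟨x, hqx, hxy⟩ := exists_zero_of_isIntegral_of_comap_le_vanishingIdeal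
      (f.pullback_pow_isIntegral hd n) hy
    refine ⟨x, ?_, funext fun i => ?_⟩
    · simpa [MvPolynomial.aeval_eq_eval] using hqx (Ideal.mem_span_singleton_self q)
    · have hi : .X i - .C (y i) ∈ (MvPolynomial.vanishingIdeal K {x}).comap (f.pullback ^ n) := by
        rw [hxy]
        simp
      rw [Ideal.mem_comap, MvPolynomial.mem_vanishingIdeal_singleton_iff,
        MvPolynomial.aeval_eq_eval, eval_pullback_pow] at hi
      simpa [sub_eq_zero] using hi

theorem exists_image_iterate_coordMap_eq [Fintype ι] [DecidableEq ι] {f : ProjEndo K ι d}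
    (hd : d ≠ 0) (hf : f.IsPCF) {q : MvPolynomial ι K} (hq : Prime q) (hqJ : q ∣ f.jacobian.det) :
    ∃ m n, 1 ≤ m ∧ m < n ∧ f.coordMap^[m] '' {x | MvPolynomial.eval x q = 0} =
      f.coordMap^[n] '' {x | MvPolynomial.eval x q = 0} := by
  obtain ⟨G, hG, hvanish⟩ := exists_form_vanishing_of_isPCF hd hf
  let 𝔭 (n : ℕ) := (Ideal.span {q}).comap (f.pullback ^ (n + 1))
  have hmin (n : ℕ) : 𝔭 n ∈ (Ideal.span {G}).minimalPrimes := by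
    refine comap_span_singleton_mem_minimalPrimes (f.pullback_pow_isIntegral hd _)
      (f.pullback_pow_injective hd _) hq hG ((f.dvd_pullback_pow_iff hq _ _).mpr fun x hx => ?_)
    obtain ⟨r, hr⟩ := hqJ
    exact hvanish _ n.succ_pos x (by rw [hr, map_mul, hx, zero_mul])
  obtain ⟨m, n, hmn, h𝔭⟩ : ∃ m n, m < n ∧ 𝔭 m = 𝔭 n := by
    obtain ⟨m, -, n, -, hmn, h⟩ := Set.infinite_univ.exists_lt_map_eq_of_mapsTo
      (fun n _ => hmin n) (Ideal.finite_minimalPrimes_of_isNoetherianRing _ _)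
    exact ⟨m, n, hmn, h⟩
  refine ⟨m + 1, n + 1, m.succ_pos, Nat.succ_lt_succ hmn, Set.ext fun y => ?_⟩
  rw [f.mem_image_iterate_coordMap_iff hd, f.mem_image_iterate_coordMap_iff hd]
  exact (congrArg (· ≤ MvPolynomial.vanishingIdeal K {y}) h𝔭).to_iff

end ProjEndo

/-- The self-map `x ↦ A x^d + b` of affine space. -/
def affineMap {R ι : Type*} [CommRing R] [Fintype ι] (d : ℕ) (A : Matrix ι ι R) (b x : ι → R) :
    ι → R :=
  A.mulVec (x ^ d) + b

section Unicritical

variable {K : Type*} [Field K] [IsAlgClosed K] {N d : ℕ} (hd : 2 ≤ d)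
  (A : Matrix.SpecialLinearGroup (Fin N) K) (b : Fin N → K)

theorem coordMap_unicritical (x : Fin N ⊕ Unit → K) :
    (unicritical hd A b).coordMap x = (blockMatrix A b).mulVec (x ^ d) := by
  funext i
  simp [ProjEndo.coordMap, unicritical, Matrix.mulVec, dotProduct]

theorem semiconj_inr_coordMap_unicritical :
    Function.Semiconj (fun x : Fin N ⊕ Unit → K => x (.inr ())) (unicritical hd A b).coordMap
      (· ^ d) := by
  intro x
  simp [coordMap_unicritical, blockMatrix, Matrix.fromBlocks_mulVec]

theorem semiconj_sumElim_one_affineMap :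
    Function.Semiconj (fun y : Fin N → K => Sum.elim y 1) (affineMap d A.1 b)
      (unicritical hd A b).coordMap := by
  intro y
  rw [coordMap_unicritical, blockMatrix, Matrix.fromBlocks_mulVec]
  ext (i | i)
  · simp [affineMap, Matrix.mulVec, dotProduct]
  · simp

theorem jacobian_unicritical :
    (unicritical hd A b).jacobian = (blockMatrix A b).map MvPolynomial.C *
      Matrix.diagonal fun j => (d : MvPolynomial _ K) * MvPolynomial.X j ^ (d - 1) := by
  ext1 i j
  rw [Matrix.mul_diagonal, ProjEndo.jacobian, Matrix.of_apply, unicritical]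
  simp only [map_sum, MvPolynomial.pderiv_C_mul, Matrix.map_apply]
  rw [Finset.sum_eq_single j]
  · simp [Derivation.leibniz_pow]
  · intro l _ hl
    simp [Derivation.leibniz_pow, MvPolynomial.pderiv_X_of_ne hl]
  · simp

theorem X_dvd_det_jacobian_unicritical (j : Fin N ⊕ Unit) :
    MvPolynomial.X j ∣ (unicritical hd A b).jacobian.det := by
  rw [jacobian_unicritical, Matrix.det_mul, Matrix.det_diagonal]
  refine Dvd.dvd.mul_left (Dvd.dvd.trans ?_ (Finset.dvd_prod_of_mem _ (Finset.mem_univ j))) _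
  exact (dvd_pow_self _ (by omega)).mul_left _

theorem exists_iterate_affineMap_eq_of_isPCF (h : (unicritical hd A b).IsPCF) (j : Fin N) :
    ∃ m n, 1 ≤ m ∧ m < n ∧
      ∃ y : Fin N → K, y j = 0 ∧ (affineMap d A.1 b)^[n] y = (affineMap d A.1 b)^[m] 0 := by
  obtain ⟨m, n, hm, hmn, himage⟩ := ProjEndo.exists_image_iterate_coordMap_eq (by omega) h
    (q := .X (.inl j)) MvPolynomial.X_prime (X_dvd_det_jacobian_unicritical hd A b _)
  have horigin : (unicritical hd A b).coordMap^[m] (Sum.elim 0 1) ∈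
      (unicritical hd A b).coordMap^[n] '' {x | MvPolynomial.eval x (.X (.inl j)) = 0} :=
    himage ▸ Set.mem_image_of_mem _ (by simp)
  have haffine (n : ℕ) (y : Fin N → K) : (unicritical hd A b).coordMap^[n] (Sum.elim y 1) =
      Sum.elim ((affineMap d A.1 b)^[n] y) 1 :=
    ((semiconj_sumElim_one_affineMap hd A b).iterate_right n y).symm
  obtain ⟨x, hxj, hx⟩ := horigin
  rw [haffine] at hx
  set c := x (.inr ()) with hc
  have hcn : c ^ d ^ n = 1 := by
    have h := (semiconj_inr_coordMap_unicritical hd A b).iterate_right n x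
    simpa [hx, pow_iterate] using h.symm
  have hc0 : c ≠ 0 := by
    rintro h0
    simp [h0, show d ≠ 0 by omega] at hcn
  have hx_eq : x = c • Sum.elim (c⁻¹ • (x ∘ .inl)) 1 := by
    ext (i | i)
    · simp [hc0]
    · simp [c]
  refine ⟨m, n, hm, hmn, c⁻¹ • (x ∘ .inl), ?_, ?_⟩
  · simpa using Or.inr hxj
  · rw [hx_eq, ProjEndo.iterate_coordMap_smul, hcn, one_smul, haffine] at hx
    exact (Sum.elim_eq_iff.mp hx).1

end Unicritical

section Valuation

variable {K Γ₀ ι : Type*} [Field K] [LinearOrderedCommGroupWithZero Γ₀] (v : Valuation K Γ₀)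
  [Fintype ι]

/-- The supremum norm of a vector with respect to a valuation, used to measure the escape of
orbits. -/
def supNorm (y : ι → K) : Γ₀ :=
  Finset.univ.sup fun i => v (y i)

variable {v}

theorem le_supNorm (y : ι → K) (i : ι) : v (y i) ≤ supNorm v y :=
  Finset.le_sup (f := fun i => v (y i)) (Finset.mem_univ i)

theorem supNorm_le_iff {y : ι → K} {B : Γ₀} : supNorm v y ≤ B ↔ ∀ i, v (y i) ≤ B := by
  simp [supNorm, Finset.sup_le_iff]

theorem exists_eq_supNorm {y : ι → K} (h : supNorm v y ≠ 0) : ∃ i, v (y i) = supNorm v y := by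
  by_contra! hne
  have hlt : supNorm v y < supNorm v y :=
    (Finset.sup_lt_iff (bot_le.trans_lt (zero_lt_iff.mpr h))).mpr
      fun i _ => (le_supNorm y i).lt_of_ne (hne i)
  exact hlt.false

theorem supNorm_smul (c : K) (y : ι → K) : supNorm v (c • y) = v c * supNorm v y := by
  refine le_antisymm (supNorm_le_iff.mpr fun i => ?_) ?_
  · rw [Pi.smul_apply, smul_eq_mul, map_mul]
    exact mul_le_mul_right (le_supNorm y i) _
  · rcases eq_or_ne (supNorm v y) 0 with h | h
    · simp [h]
    · obtain ⟨i, hi⟩ := exists_eq_supNorm h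
      rw [← hi, ← map_mul]
      exact le_supNorm (c • y) i

theorem supNorm_pow {d : ℕ} (hd : d ≠ 0) (y : ι → K) : supNorm v (y ^ d) = supNorm v y ^ d := by
  refine le_antisymm (supNorm_le_iff.mpr fun i => ?_) ?_
  · rw [Pi.pow_apply, map_pow]
    exact pow_le_pow_left' (le_supNorm y i) d
  · rcases eq_or_ne (supNorm v y) 0 with h | h
    · simp [h, hd]
    · obtain ⟨i, hi⟩ := exists_eq_supNorm h
      rw [← hi, ← map_pow]
      exact le_supNorm (y ^ d) i

theorem supNorm_add_eq_left {y z : ι → K} (h : supNorm v z < supNorm v y) :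
    supNorm v (y + z) = supNorm v y := by
  refine le_antisymm (supNorm_le_iff.mpr fun i => ?_) ?_
  · exact (v.map_add _ _).trans (max_le (le_supNorm y i) ((le_supNorm z i).trans h.le))
  · obtain ⟨i, hi⟩ := exists_eq_supNorm (zero_le.trans_lt h).ne'
    have hadd := v.map_add_eq_of_lt_left (((le_supNorm z i).trans_lt h).trans_eq hi.symm)
    rw [← hi, ← hadd]
    exact le_supNorm (y + z) i

theorem supNorm_mulVec_le {M : Matrix ι ι K} (hM : ∀ i j, v (M i j) ≤ 1) (y : ι → K) :
    supNorm v (M.mulVec y) ≤ supNorm v y := by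
  refine supNorm_le_iff.mpr fun i => v.map_sum_le fun j _ => ?_
  rw [map_mul]
  exact (mul_le_of_le_one_left' (hM i j)).trans (le_supNorm y j)

variable [DecidableEq ι] {M : Matrix ι ι K} (hM : ∀ i j, v (M i j) ≤ 1)

include hM

theorem valuation_adjugate_le_one (i j : ι) : v (M.adjugate i j) ≤ 1 := by
  let M' : Matrix ι ι v.integer := Matrix.of fun i j => ⟨M i j, hM i j⟩
  have h : M = v.integer.subtype.mapMatrix M' := rfl
  rw [h, ← RingHom.map_adjugate]
  exact (M'.adjugate i j).2

variable (hdet : v M.det = 1)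

include hdet

theorem supNorm_mulVec (y : ι → K) : supNorm v (M.mulVec y) = supNorm v y := by
  refine le_antisymm (supNorm_mulVec_le hM y) ?_
  calc supNorm v y = supNorm v (M.adjugate.mulVec (M.mulVec y)) := by
        rw [Matrix.mulVec_mulVec, Matrix.adjugate_mul, Matrix.smul_mulVec, Matrix.one_mulVec,
          supNorm_smul, hdet, one_mul]
    _ ≤ supNorm v (M.mulVec y) := supNorm_mulVec_le (valuation_adjugate_le_one hM) _

theorem supNorm_adjugate_mulVec (y : ι → K) : supNorm v (M.adjugate.mulVec y) = supNorm v y :=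
  supNorm_mulVec (valuation_adjugate_le_one hM)
    (by rw [Matrix.det_adjugate, map_pow, hdet, one_pow]) y

variable {d : ℕ} {b : ι → K}

theorem supNorm_le_supNorm_affineMap (hd : d ≠ 0) {j : ι}
    (hj : v (M.adjugate.mulVec b j) = supNorm v b) {y : ι → K} (hy : y j = 0) :
    supNorm v b ≤ supNorm v (affineMap d M b y) := by
  have hadj : M.adjugate.mulVec (affineMap d M b y) j = M.adjugate.mulVec b j := by
    rw [affineMap, Matrix.mulVec_add, Matrix.mulVec_mulVec, Matrix.adjugate_mul,
      Matrix.smul_mulVec, Matrix.one_mulVec]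
    simp [hy, hd]
  rw [← hj, ← hadj, ← supNorm_adjugate_mulVec hM hdet (affineMap d M b y)]
  exact le_supNorm _ j

variable (hd : 1 < d)

include hd

theorem supNorm_affineMap (hb : 1 < supNorm v b) {y : ι → K} (hy : supNorm v b ≤ supNorm v y) :
    supNorm v (affineMap d M b y) = supNorm v y ^ d := by
  have hpow : supNorm v (M.mulVec (y ^ d)) = supNorm v y ^ d := by
    rw [supNorm_mulVec hM hdet, supNorm_pow (by omega)]
  rw [affineMap, supNorm_add_eq_left, hpow]
  exact hpow ▸ hy.trans_lt (lt_self_pow₀ (hb.trans_le hy) hd)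

theorem supNorm_iterate_affineMap (hb : 1 < supNorm v b) {y : ι → K}
    (hy : supNorm v b ≤ supNorm v y) (n : ℕ) :
    supNorm v ((affineMap d M b)^[n] y) = supNorm v y ^ d ^ n := by
  induction n generalizing y with
  | zero => simp
  | succ n ih =>
    have hstep := supNorm_affineMap hM hdet hd hb hy
    rw [Function.iterate_succ_apply, ih, hstep, ← pow_mul, pow_succ']
    exact hstep ▸ hy.trans (le_self_pow₀ (hb.le.trans hy) (by omega))

theorem exists_forall_iterate_affineMap_ne (hb : 1 < supNorm v b) :
    ∃ j, ∀ m n, 1 ≤ m → m < n → ∀ y : ι → K, y j = 0 →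
      (affineMap d M b)^[n] y ≠ (affineMap d M b)^[m] 0 := by
  have hadj := supNorm_adjugate_mulVec hM hdet b
  obtain ⟨j, hj⟩ := exists_eq_supNorm (v := v) (y := M.adjugate.mulVec b)
    (hadj ▸ (zero_lt_one.trans hb).ne')
  refine ⟨j, fun m n hm hmn y hy hmeet => ?_⟩
  have hfirst := supNorm_le_supNorm_affineMap hM hdet (by omega : d ≠ 0) (hj.trans hadj) hy
  have hzero : affineMap d M b 0 = b := by simp [affineMap, show d ≠ 0 by omega]
  obtain ⟨m, rfl⟩ := Nat.exists_eq_add_of_le' hm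
  obtain ⟨n, rfl⟩ := Nat.exists_eq_add_of_le' (hm.trans hmn.le)
  have hnorm := congrArg (supNorm v) hmeet
  rw [Function.iterate_succ_apply, Function.iterate_succ_apply, hzero,
    supNorm_iterate_affineMap hM hdet hd hb hfirst,
    supNorm_iterate_affineMap hM hdet hd hb le_rfl] at hnorm
  refine hnorm.not_gt ?_
  calc supNorm v b ^ d ^ m < supNorm v b ^ d ^ n :=
        pow_lt_pow_right₀ hb (Nat.pow_lt_pow_right hd (by omega))
    _ ≤ supNorm v (affineMap d M b y) ^ d ^ n := pow_le_pow_left' hfirst _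

end Valuation

theorem isIntegral_of_isPCF {R K : Type*} [CommRing R] [Field K] [IsAlgClosed K] [Algebra R K]
    {N d : ℕ} (hd : 2 ≤ d) {A : Matrix.SpecialLinearGroup (Fin N) K}
    (hA : ∀ i j, IsIntegral R (A.1 i j)) {b : Fin N → K} (h : (unicritical hd A b).IsPCF)
    (i : Fin N) : IsIntegral R (b i) := by
  refine isIntegral_of_forall_valuationSubring fun O hO => ?_
  have hAO (i j) : O.valuation (A.1 i j) ≤ 1 :=
    valuation_le_one_of_isIntegral (fun r => (O.valuation_le_one_iff _).mpr (hO r)) (hA i j)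
  by_contra hbi
  have hb : 1 < supNorm O.valuation b :=
    (not_le.mp (mt (O.valuation_le_one_iff _).mp hbi)).trans_le (le_supNorm b i)
  obtain ⟨j, hj⟩ := exists_forall_iterate_affineMap_ne hAO (by rw [A.2, map_one]) hd hb
  obtain ⟨m, n, hm, hmn, y, hy, hmeet⟩ := exists_iterate_affineMap_eq_of_isPCF hd A b h j
  exact hj m n hm hmn y hy hmeet

section Arithmetic

theorem isJacobsonRing_int : IsJacobsonRing ℤ := by
  refine isJacobsonRing_iff_prime_eq.mpr fun P hP => ?_
  rcases eq_or_ne P ⊥ with rfl | hne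
  · refine le_antisymm (fun n hn => ?_) Ideal.le_jacobson
    have hunit : IsUnit (n * n + 1) := Ideal.mem_jacobson_bot.mp hn n
    rcases Int.isUnit_iff.mp hunit with h | h
    · exact (Submodule.mem_bot ℤ).mpr (mul_self_eq_zero.mp (by linarith))
    · nlinarith
  · have := hP.isMaximal hne
    exact Ideal.jacobson_eq_self_of_isMaximal

theorem not_isIntegral_int {k : Type*} [Field k]
    (hk : ∀ (p : ℕ) [Fact p.Prime] [Algebra (ZMod p) k], ¬ Algebra.IsAlgebraic (ZMod p) k) :
    ¬ Algebra.IsIntegral ℤ k := by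
  intro hZ
  obtain ⟨p, hp⟩ := CharP.exists k
  rcases CharP.char_is_prime_or_zero k p with hprime | rfl
  · have := Fact.mk hprime
    let _ := ZMod.algebra k p
    exact hk p ⟨fun x => ((hZ.isIntegral x).tower_top (A := ZMod p)).isAlgebraic⟩
  · have := CharP.charP_to_charZero k
    exact Int.not_isField (isField_of_isIntegral_of_isField
      (FaithfulSMul.algebraMap_injective ℤ k) (Field.toIsField k))

theorem exists_not_isIntegral_adjoin {k : Type*} [Field k] (hk : ¬ Algebra.IsIntegral ℤ k)
    {s : Set k} (hs : s.Finite) : ∃ x : k, ¬ IsIntegral (Algebra.adjoin ℤ s) x := by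
  by_contra! hall
  have : Algebra.IsIntegral (Algebra.adjoin ℤ s) k := ⟨hall⟩
  have hfield : IsField (Algebra.adjoin ℤ s) := isField_of_isIntegral_of_isField
    (FaithfulSMul.algebraMap_injective (Algebra.adjoin ℤ s) k) (Field.toIsField k)
  have : Algebra.FiniteType ℤ (Algebra.adjoin ℤ s) :=
    (Subalgebra.fg_iff_finiteType _).mp ⟨hs.toFinset, by simp⟩
  have : Module.Finite ℤ (Algebra.adjoin ℤ s) := by
    have := isJacobsonRing_int
    let _ := hfield.toField
    exact finite_of_finite_type_of_isJacobsonRing ℤ (Algebra.adjoin ℤ s)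
  exact hk (Algebra.IsIntegral.trans (Algebra.adjoin ℤ s))

theorem infinite_setOf_not_isIntegral {R k : Type*} [CommRing R] [CommRing k] [Infinite k]
    [Algebra R k] (h : ∃ x : k, ¬ IsIntegral R x) : {x : k | ¬ IsIntegral R x}.Infinite := by
  obtain ⟨x, hx⟩ := h
  intro hfin
  have hint : {y : k | IsIntegral R y}.Finite :=
    (hfin.preimage (add_right_injective x).injOn).subset fun y hy hxy =>
      hx (by simpa using hxy.sub hy)
  exact Set.infinite_univ ((hfin.union hint).subset fun y _ => (em (IsIntegral R y)).symm)

theorem exists_ne_zero_basicOpen_subset_range_comap {R S : Type*} [CommRing R] [IsDedekindDomain R]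
    [CommRing S] [IsDomain S] [Algebra R S] [FaithfulSMul R S] [Algebra.FiniteType R S] :
    ∃ h : R, h ≠ 0 ∧ (PrimeSpectrum.basicOpen h : Set (PrimeSpectrum R)) ⊆
      Set.range (PrimeSpectrum.comap (algebraMap R S)) := by
  have : Algebra.FinitePresentation R S := Algebra.FinitePresentation.of_finiteType.mp inferInstance
  have : Module.Flat R S := IsDedekindDomain.flat_iff_torsion_eq_bot.mpr
    (Submodule.isTorsionFree_iff_torsion_eq_bot.mp inferInstance)
  have hopen := (PrimeSpectrum.isOpenMap_comap_of_hasGoingDown_of_finitePresentation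
    (R := R) (S := S)).isOpen_range
  have hbot : (⊥ : PrimeSpectrum R) ∈ Set.range (PrimeSpectrum.comap (algebraMap R S)) :=
    ⟨⊥, PrimeSpectrum.ext
      (Ideal.comap_bot_of_injective _ (FaithfulSMul.algebraMap_injective R S))⟩
  obtain ⟨_, ⟨_, ⟨h, rfl⟩, rfl⟩, hh, hsub⟩ :=
    PrimeSpectrum.isBasis_basic_opens.exists_subset_of_mem_open hbot hopen
  exact ⟨h, by rintro rfl; simp at hh, hsub⟩

theorem finite_resolventSet_of_transcendental {k S : Type*} [Field k] [CommRing S] [IsDomain S]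
    [Algebra k S] [Algebra.FiniteType k S] {s : S} (hs : Transcendental k s) :
    (resolventSet k s).Finite := by
  algebraize [(Polynomial.aeval (R := k) s).toRingHom]
  have : FaithfulSMul (Polynomial k) S :=
    (faithfulSMul_iff_algebraMap_injective _ _).mpr (transcendental_iff_injective.mp hs)
  have : IsScalarTower k (Polynomial k) S :=
    .of_algebraMap_eq fun c => by simp [RingHom.algebraMap_toAlgebra]
  have : Algebra.FiniteType (Polynomial k) S := .of_restrictScalars_finiteType k _ S
  obtain ⟨h, h0, hsub⟩ := exists_ne_zero_basicOpen_subset_range_comap (R := Polynomial k) (S := S)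
  refine (h.rootSet_finite k).subset fun β hβ => ?_
  by_contra hroot
  have hprime : (Ideal.span {Polynomial.X - Polynomial.C β}).IsPrime :=
    (Ideal.span_singleton_prime (Polynomial.X_sub_C_ne_zero β)).mpr (Polynomial.prime_X_sub_C β)
  obtain ⟨q, hq⟩ := hsub (a := ⟨_, hprime⟩) fun hmem => hroot <| by
    rw [Polynomial.mem_rootSet]
    exact ⟨h0, by simpa using Polynomial.dvd_iff_isRoot.mp (Ideal.mem_span_singleton.mp hmem)⟩
  have hsq : s - algebraMap k S β ∈ q.asIdeal := by
    have hmem : Polynomial.X - Polynomial.C β ∈ q.asIdeal.comap (algebraMap (Polynomial k) S) :=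
      (congrArg PrimeSpectrum.asIdeal hq).ge (Ideal.mem_span_singleton_self _)
    simpa [RingHom.algebraMap_toAlgebra] using hmem
  exact q.2.ne_top (Ideal.eq_top_of_isUnit_mem _ hsq (IsUnit.sub_iff.mp hβ))

end Arithmetic

section Varieties

variable {k : Type u} [Field k] {V : Scheme.{u}} {π : V ⟶ Spec (.of k)}

/-- Evaluation of regular functions at a point with values in a field. -/
noncomputable def evaluation {L : Type u} [Field L] (t : Spec (.of L) ⟶ V) : Γ(V, ⊤) →+* L :=
  (t.appTop ≫ (Scheme.ΓSpecIso (.of L)).hom).hom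

theorem evaluation_const {t : Spec (.of k) ⟶ V} (ht : t ≫ π = 𝟙 _) (c : k) :
    evaluation t (const π c) = c := by
  have h : (Scheme.ΓSpecIso (.of k)).inv ≫ (t ≫ π).appTop ≫ (Scheme.ΓSpecIso (.of k)).hom =
      𝟙 (CommRingCat.of k) := by
    rw [ht]
    simp
  exact congrArg (fun g : CommRingCat.of k ⟶ CommRingCat.of k => g.hom c) h

theorem evaluation_eq_zero_iff {L : Type u} [Field L] {t : Spec (.of L) ⟶ V} {s : Γ(V, ⊤)} :
    evaluation t s = 0 ↔ t (IsLocalRing.closedPoint L) ∉ V.basicOpen s := by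
  have happ : t.appTop s = (Scheme.ΓSpecIso (.of L)).inv (evaluation t s) := by
    simp [evaluation]
  have hpre : t ⁻¹ᵁ V.basicOpen s = PrimeSpectrum.basicOpen (evaluation t s) := by
    rw [Scheme.preimage_basicOpen_top, happ, basicOpen_eq_of_affine]
  have hmem : t (IsLocalRing.closedPoint L) ∈ V.basicOpen s ↔
      IsLocalRing.closedPoint L ∈ PrimeSpectrum.basicOpen (evaluation t s) := by
    rw [← hpre]
    rfl
  rw [hmem, PrimeSpectrum.mem_basicOpen]
  simp [IsLocalRing.closedPoint]

theorem exists_notMem_basicOpen_of_not_isUnit {s : Γ(V, ⊤)} (hs : ¬ IsUnit s) :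
    ∃ x, x ∉ V.basicOpen s := by
  contrapose! hs
  exact RingedSpace.isUnit_of_isUnit_germ _ _ _ fun x hx => (V.mem_basicOpen s x hx).mp (hs x)

theorem exists_evaluation_eq_of_not_isUnit [IsAlgClosed k] [LocallyOfFiniteType π] {s : Γ(V, ⊤)}
    {β : k} (hs : ¬ IsUnit (const π β - s)) :
    ∃ t : Spec (.of k) ⟶ V, t ≫ π = 𝟙 _ ∧ evaluation t s = β := by
  have := LocallyOfFiniteType.jacobsonSpace π
  obtain ⟨x, hx, hclosed⟩ := nonempty_inter_closedPoints
    (exists_notMem_basicOpen_of_not_isUnit hs)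
    (V.basicOpen _).isOpen.isClosed_compl.isLocallyClosed
  replace hclosed : IsClosed {x} := hclosed
  have ht := pointOfClosedPoint_comp π x hclosed
  refine ⟨pointOfClosedPoint π x hclosed, ht, ?_⟩
  have hzero : evaluation (pointOfClosedPoint π x hclosed) (const π β - s) = 0 :=
    evaluation_eq_zero_iff.mpr fun h => hx (pointOfClosedPoint_apply π x hclosed _ ▸ h)
  rw [map_sub, evaluation_const ht, sub_eq_zero] at hzero
  exact hzero.symm

theorem finite_setOf_isUnit_const_sub [IsAlgClosed k] [IsIntegral V] [LocallyOfFiniteType π]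
    {s : Γ(V, ⊤)} (hs : ∀ c, s ≠ const π c) : {β | IsUnit (const π β - s)}.Finite := by
  obtain ⟨U, hU, hxU, -⟩ := exists_isAffineOpen_mem_and_subset
    (X := V) (U := ⊤) (x := genericPoint V) trivial
  have : Nonempty U := ⟨⟨_, hxU⟩⟩
  let res : Γ(V, ⊤) →+* Γ(V, U) := (V.presheaf.map (homOfLE le_top : U ⟶ ⊤).op).hom
  have hres : Function.Injective res := map_injective_of_isIntegral V (homOfLE le_top : U ⟶ ⊤)
  have hft : (res.comp (const π)).FiniteType :=
    RingHom.FiniteType.comp (g := (π.appLE ⊤ U le_top).hom)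
      (f := (Scheme.ΓSpecIso (.of k)).inv.hom)
      (π.finiteType_appLE (isAffineOpen_top _) hU le_top)
      (.of_surjective _ (Scheme.ΓSpecIso (.of k)).commRingCatIsoToRingEquiv.symm.surjective)
  algebraize [res.comp (const π)]
  have htr : Transcendental k (res s) := by
    intro h
    obtain ⟨c, hc⟩ := exists_algebraMap_eq_of_isIntegral h.isIntegral
    exact hs c (hres hc.symm)
  refine (finite_resolventSet_of_transcendental htr).subset fun β hβ => ?_
  have hunit := hβ.map res
  rwa [map_sub] at hunit

end Varieties

namespace Family

variable {N d : ℕ} (hd : 2 ≤ d) {V : Scheme.{u}} {f : Family V N}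

theorem isIntegral_of_isPCF_specialize {R : Type*} [CommRing R] {L : Type u} [Field L]
    [IsAlgClosed L] [Algebra R L] {φ : Γ(V, ⊤) →+* L} (hA : ∀ i j, IsIntegral R (φ (f.A.1 i j)))
    (hf : (f.specialize hd φ).IsPCF) (i : Fin N) : IsIntegral R (φ (f.b i)) :=
  isIntegral_of_isPCF hd hA hf i

variable {k : Type u} [Field k] [IsAlgClosed k] [IsIntegral V] {π : V ⟶ Spec (.of k)}

theorem constantB_of_isPCF_genericMember (hf : (f.genericMember hd).IsPCF) (hA : f.ConstantA π) :
    f.ConstantB π := by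
  obtain ⟨A₀, hA₀⟩ := hA
  let φ : Γ(V, ⊤) →+* AlgebraicClosure V.functionField :=
    (algebraMap V.functionField (AlgebraicClosure V.functionField)).comp
      (V.presheaf.germ ⊤ (genericPoint V) trivial).hom
  have hφ : Function.Injective φ :=
    (algebraMap V.functionField (AlgebraicClosure V.functionField)).injective.comp
      (germ_injective_of_isIntegral V (U := ⊤) (genericPoint V) trivial)
  algebraize [φ.comp (const π)]
  have hint (i) : IsIntegral k (φ (f.b i)) :=
    isIntegral_of_isPCF_specialize hd (fun i j => hA₀ ▸ isIntegral_algebraMap (x := A₀.1 i j)) hf i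
  choose b₀ hb₀ using fun i => exists_algebraMap_eq_of_isIntegral (hint i)
  exact ⟨b₀, fun i => hφ (hb₀ i).symm⟩

theorem constantB_of_forall_isPCF_member [LocallyOfFiniteType π] (hk : ¬ Algebra.IsIntegral ℤ k)
    (hf : ∀ t : Spec (.of k) ⟶ V, t ≫ π = 𝟙 _ → (f.member hd t).IsPCF) (hA : f.ConstantA π) :
    f.ConstantB π := by
  obtain ⟨A₀, hA₀⟩ := hA
  let R := Algebra.adjoin ℤ (Set.range fun ij : Fin N × Fin N => A₀.1 ij.1 ij.2)
  have := IsAlgClosed.instInfinite (K := k)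
  have hinf : {x : k | ¬ IsIntegral R x}.Infinite :=
    infinite_setOf_not_isIntegral (exists_not_isIntegral_adjoin hk (Set.finite_range _))
  suffices hconst : ∀ i, ∃ c, f.b i = const π c by
    choose b₀ hb₀ using hconst
    exact ⟨b₀, hb₀⟩
  intro i
  by_contra! hi
  obtain ⟨β, hβ, hunit⟩ := (hinf.sdiff (finite_setOf_isUnit_const_sub hi)).nonempty
  obtain ⟨t, ht, rfl⟩ := exists_evaluation_eq_of_not_isUnit hunit
  refine hβ (isIntegral_of_isPCF_specialize hd (φ := evaluation t) (fun l m => ?_) (hf t ht) i)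
  have hAlm : evaluation t (f.A.1 l m) = A₀.1 l m := by
    rw [hA₀]
    exact evaluation_const ht _
  exact hAlm ▸ isIntegral_algebraMap (x := (⟨_, Algebra.subset_adjoin ⟨(l, m), rfl⟩⟩ : R))

end Family

end PCF

theorem mainTheorem6_general {k : Type u} [Field k] [IsAlgClosed k] (N d : ℕ) (hd : 2 ≤ d)
    {V : Scheme.{u}} (π : V ⟶ Spec (.of k)) [IsIntegral V] :
    (∀ f : PCF.Family V N, (f.genericMember hd).IsPCF → f.ConstantA π → f.ConstantB π) ∧
    (∀ [LocallyOfFiniteType π],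
      (∀ (p : ℕ) [Fact p.Prime] [Algebra (ZMod p) k], ¬ Algebra.IsAlgebraic (ZMod p) k) →
      ∀ f : PCF.Family V N,
        (∀ t : Spec (.of k) ⟶ V, t ≫ π = 𝟙 _ → (f.member hd t).IsPCF) →
          f.ConstantA π → f.ConstantB π) :=
  ⟨fun _ => PCF.Family.constantB_of_isPCF_genericMember hd,
    fun hk _ => PCF.Family.constantB_of_forall_isPCF_member hd (PCF.not_isIntegral_int hk)⟩

theorem mainTheorem6 {k : Type u} [Field k] [IsAlgClosed k] (N d : ℕ) (hd : 2 ≤ d)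
    (hchar : ringChar k = 0 ∨ d < ringChar k)
    {V : Scheme.{u}} (π : V ⟶ Spec (.of k)) [IsIntegral V] [IsSeparated π]
    [LocallyOfFiniteType π] [QuasiCompact π] :
    (¬ ∃ f : PCF.Family V N, (f.genericMember hd).IsPCF ∧ f.ConstantA π ∧ ¬ f.ConstantB π) ∧
    ((∀ (p : ℕ) [Fact p.Prime] [Algebra (ZMod p) k], ¬ Algebra.IsAlgebraic (ZMod p) k) →
      ¬ ∃ f : PCF.Family V N,
        (∀ t : Spec (.of k) ⟶ V, t ≫ π = 𝟙 _ → (f.member hd t).IsPCF) ∧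
          f.ConstantA π ∧ ¬ f.ConstantB π) := by
  obtain ⟨hgeneric, hmembers⟩ := mainTheorem6_general N d hd π
  exact ⟨fun ⟨f, hf, hA, hb⟩ => hb (hgeneric f hf hA),
    fun hk ⟨f, hf, hA, hb⟩ => hb (hmembers hk f hf hA)⟩
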